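/- Let $n\ge 2$ be an even integer and let $u,Q\in C^\infty(\mathbb{R}^n)$ be real-valued. Suppose that $u$ is radially symmetric (i.e. $u(x)$ depends only on $|x|$) and that $u$ is a normal solution of $(-\Delta)^{n/2}u=Qe^{nu}$ on $\mathbb{R}^n$; that is, this equation holds on $\mathbb{R}^n$, $Qe^{nu}\in L^1(\mathbb{R}^n)$, and there is a constant $C\in\mathbb{R}$ such that for all $x\in\mathbb{R}^n$ $$u(x)=\frac{2}{(n-1)!\,|\mathbb{S}^n|}\int_{\mathbb{R}^n}\log\frac{|y|}{|x-y|}\,Q(y)e^{nu(y)}\,dy+C,$$ where $|\mathbb{S}^n|$ denotes the volume of the standard unit $n$-sphere. If $Q(x)\le (n-1)!$ for all $x\in\mathbb{R}^n$, then $$\int_{\mathbb{R}^n}e^{nu}\,dx\ \ge\ |\mathbb{S}^n|$$ (the left-hand side may be $+\infty$), and equality holds if and only if $Q(x)=(n-1)!$ for all $x\in\mathbb{R}^n$. -/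

import Mathlib

open MeasureTheory
open scoped ENNReal ContDiff Laplacian

noncomputable section

namespace BolInequality

/-- The volume `|𝕊ⁿ|` of the unit sphere of `ℝⁿ⁺¹`, for its surface measure. -/
def sphereVolume (n : ℕ) : ℝ≥0∞ :=
  (volume : Measure (EuclideanSpace ℝ (Fin (n + 1)))).toSphere Set.univ

/-- The operator `(-Δ)ᵏ` on functions on `ℝⁿ`. -/
def negLaplacianPow {n : ℕ} (k : ℕ) (u : EuclideanSpace ℝ (Fin n) → ℝ) :
    EuclideanSpace ℝ (Fin n) → ℝ :=
  (fun (f : EuclideanSpace ℝ (Fin n) → ℝ) x => -(Δ f x))^[k] u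

/-- `u` is a normal solution of `(-Δ)^(n/2) u = Q e^{nu}` on `ℝⁿ` (`n` even). -/
structure IsNormalSolution {n : ℕ} (u Q : EuclideanSpace ℝ (Fin n) → ℝ) : Prop where
  integrable : Integrable (fun x => Q x * Real.exp (n * u x))
  equation : ∀ x, negLaplacianPow (n / 2) u x = Q x * Real.exp (n * u x)
  /-- For every `x` the integrand below is integrable as soon as `u`, `Q` are continuous and
  `Q e^{nu}` is integrable. -/
  integral_equation : ∃ C : ℝ, ∀ x, u x =
    2 / ((Nat.factorial (n - 1) : ℝ) * (sphereVolume n).toReal) *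
      (∫ y, Real.log (‖y‖ / ‖x - y‖) * (Q y * Real.exp (n * u y))) + C

/-- `u(x)` depends on `|x|` only. -/
def IsRadial {n : ℕ} (u : EuclideanSpace ℝ (Fin n) → ℝ) : Prop :=
  ∀ x y, ‖x‖ = ‖y‖ → u x = u y

/-- The volume `∫ e^{nu} dx ∈ [0, ∞]` of `ℝⁿ` with the conformal metric `e^{2u}|dx|²`. -/
def conformalVolume {n : ℕ} (u : EuclideanSpace ℝ (Fin n) → ℝ) : ℝ≥0∞ :=
  ∫⁻ x, ENNReal.ofReal (Real.exp (n * u x))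

end BolInequality

end

/-! Let `w = e^{nu}`, `V = ∫ w` (assumed finite, the other case being easy) and `c = 2 / ((n-1)!
|𝕊ⁿ|)`. The dilation `x ↦ e^t x` scales `V` exactly, so differentiating at `t = 0` gives a Pohozaev
identity `V = c ∬ K(x,y) w(x) Q(y) w(y)`, where `K` is the dilation derivative of the logarithmic
kernel (`volume_eq_kernel_integral`).

Taken directly, `K = x·(x-y)/|x-y|²` is unbounded and changes sign. But `n` is even, so `ℝⁿ` has a
complex structure, and a radial `u` is invariant under `e^{iθ}`. Hence `log |x-y|` may be replaced
by its mean over `θ`, which is `½ log P` with `P` the larger root of `X² - (|x|²+|y|²) X +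
|⟨x,y⟩_ℂ|²`. For this mean, when `|x| ≠ |y|`, one has `0 ≤ K ≤ 1` and `K(x,y) + K(y,x) = 1`; also `K
> 0` where `|y| < |x|`.

Symmetrizing, `∬ K w w = V²/2` (`integral_meanKernel_mul_mul`). Subtracting the Pohozaev identity
yields `(n-1)!/2 · V (V - |𝕊ⁿ|) = ∬ K w(x) ((n-1)! - Q(y)) w(y)` (`volume_deficit_eq`). The right
side is nonnegative, and vanishes only if `Q` is constantly `(n-1)!`. -/

namespace BolInequality

/-! ### The larger root of a quadratic and circular means of the logarithm. -/

/-- The larger root of `X² - (a + b) X + T`. -/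
noncomputable def upperRoot (a b T : ℝ) : ℝ := (a + b + √((a + b) ^ 2 - 4 * T)) / 2

/-- The derivative at `t = 0` of `½ log (upperRoot (e^{2t} a) b (e^{2t} T))`. -/
noncomputable def rootKernel (a b T : ℝ) : ℝ :=
  (a * (a + b + √((a + b) ^ 2 - 4 * T)) - 2 * T) /
    (√((a + b) ^ 2 - 4 * T) * (a + b + √((a + b) ^ 2 - 4 * T)))

section UpperRoot

variable {a b T : ℝ}

theorem upperRoot_comm (a b T : ℝ) : upperRoot a b T = upperRoot b a T := by
  simp only [upperRoot, add_comm a b]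

theorem discriminant_ge (hT : T ≤ a * b) : (a - b) ^ 2 ≤ (a + b) ^ 2 - 4 * T := by
  nlinarith

theorem discriminant_nonneg (hT : T ≤ a * b) : 0 ≤ (a + b) ^ 2 - 4 * T :=
  (sq_nonneg _).trans (discriminant_ge hT)

theorem upperRoot_quadratic (hT : T ≤ a * b) :
    upperRoot a b T ^ 2 - (a + b) * upperRoot a b T + T = 0 := by
  have h := Real.sq_sqrt (discriminant_nonneg hT)
  unfold upperRoot
  nlinarith

/-- A monic quadratic is nonpositive only between its roots. The bounds on `upperRoot` below come
from evaluating the quadratic at a test point. -/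
theorem le_upperRoot {x : ℝ} (hx : x ^ 2 - (a + b) * x + T ≤ 0) : x ≤ upperRoot a b T := by
  have h : 2 * x - (a + b) ≤ √((a + b) ^ 2 - 4 * T) :=
    Real.le_sqrt_of_sq_le (by nlinarith)
  unfold upperRoot
  linarith

theorem left_le_upperRoot (hT : T ≤ a * b) : a ≤ upperRoot a b T :=
  le_upperRoot (by nlinarith)

theorem right_le_upperRoot (hT : T ≤ a * b) : b ≤ upperRoot a b T :=
  le_upperRoot (by nlinarith)

theorem upperRoot_pos (hb : 0 < b) (hT : T ≤ a * b) : 0 < upperRoot a b T :=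
  hb.trans_le (right_le_upperRoot hT)

theorem upperRoot_smul {l : ℝ} (hl : 0 ≤ l) :
    upperRoot (l * a) (l * b) (l ^ 2 * T) = l * upperRoot a b T := by
  have h : (l * a + l * b) ^ 2 - 4 * (l ^ 2 * T) = l ^ 2 * ((a + b) ^ 2 - 4 * T) := by ring
  rw [upperRoot, upperRoot, h, Real.sqrt_mul (sq_nonneg l), Real.sqrt_sq hl]
  ring

/-- At `P = upperRoot a b T` the scaled quadratic equals `(l - 1) * (T - a * P)`, which is
nonpositive since `T ≤ a * b ≤ a * P`. -/
theorem upperRoot_le_upperRoot_smul_left {l : ℝ} (hl : 1 ≤ l) (ha : 0 ≤ a) (hT : T ≤ a * b) :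
    upperRoot a b T ≤ upperRoot (l * a) b (l * T) := by
  apply le_upperRoot
  have h1 := upperRoot_quadratic hT
  have h2 : T ≤ a * upperRoot a b T :=
    hT.trans (mul_le_mul_of_nonneg_left (right_le_upperRoot hT) ha)
  nlinarith [mul_nonneg (sub_nonneg.2 hl) (sub_nonneg.2 h2)]

/-- By homogeneity this is the preceding monotonicity in the other variable: pass from `(l * a, b)`
to `(l * a, l * b)`. -/
theorem upperRoot_smul_left_le {l : ℝ} (hl : 1 ≤ l) (hb : 0 ≤ b) (hT : T ≤ a * b) :
    upperRoot (l * a) b (l * T) ≤ l * upperRoot a b T := by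
  have hl0 : 0 ≤ l := by linarith
  have h := upperRoot_le_upperRoot_smul_left (a := b) (b := l * a) (T := l * T) hl hb
    (by nlinarith)
  rw [← upperRoot_smul hl0, upperRoot_comm, upperRoot_comm (l * a)]
  convert h using 2
  ring

/-- `t ↦ ½ log (upperRoot (e^{2t} a) b (e^{2t} T))`, the circular mean of `log |e^t x - y|`. -/
noncomputable def logMean (a b T t : ℝ) : ℝ :=
  Real.log (upperRoot (Real.exp (2 * t) * a) b (Real.exp (2 * t) * T)) / 2

theorem logMean_zero (a b T : ℝ) : logMean a b T 0 = Real.log (upperRoot a b T) / 2 := by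
  simp [logMean]

theorem exp_mul_le_mul (hT : T ≤ a * b) (t : ℝ) :
    Real.exp (2 * t) * T ≤ Real.exp (2 * t) * a * b := by
  rw [mul_assoc]
  exact mul_le_mul_of_nonneg_left hT (Real.exp_pos _).le

/-- Integrated form of `0 ≤ K ≤ 1`. It needs no derivative, so it also covers the times when `|e^t
x| = |y|`. -/
theorem logMean_mono_sub (ha : 0 ≤ a) (hb : 0 < b) (hT : T ≤ a * b) {s t : ℝ} (hst : s ≤ t) :
    logMean a b T s ≤ logMean a b T t ∧ logMean a b T t ≤ logMean a b T s + (t - s) := by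
  have hl : 1 ≤ Real.exp (2 * (t - s)) := Real.one_le_exp (by linarith)
  have hs := exp_mul_le_mul hT s
  have has : 0 ≤ Real.exp (2 * s) * a := mul_nonneg (Real.exp_pos _).le ha
  have e : Real.exp (2 * t) = Real.exp (2 * (t - s)) * Real.exp (2 * s) := by
    rw [← Real.exp_add]; congr 1; ring
  have h0 := upperRoot_pos hb hs
  have h1 := upperRoot_le_upperRoot_smul_left hl has hs
  have h2 := upperRoot_smul_left_le hl hb.le hs
  rw [← mul_assoc, ← mul_assoc, ← e] at h1 h2
  have h3 := Real.log_le_log h0 h1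
  have h4 := Real.log_le_log (h0.trans_le h1) h2
  rw [Real.log_mul (Real.exp_pos _).ne' h0.ne', Real.log_exp] at h4
  constructor
  · unfold logMean; linarith
  · unfold logMean; linarith

theorem abs_logMean_sub_le (ha : 0 ≤ a) (hb : 0 < b) (hT : T ≤ a * b) (s t : ℝ) :
    |logMean a b T s - logMean a b T t| ≤ |s - t| := by
  rcases le_total s t with h | h
  · have := logMean_mono_sub ha hb hT h
    rw [abs_sub_comm s, abs_of_nonneg (sub_nonneg.2 h), abs_le]
    constructor <;> linarith
  · have := logMean_mono_sub ha hb hT h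
    rw [abs_of_nonneg (sub_nonneg.2 h), abs_le]
    constructor <;> linarith

theorem sqrt_discriminant_pos (hab : a ≠ b) (hT : T ≤ a * b) : 0 < √((a + b) ^ 2 - 4 * T) :=
  Real.sqrt_pos.2 ((pow_pos (abs_pos.2 (sub_ne_zero.2 hab)) 2).trans_le
    (by rw [sq_abs]; exact discriminant_ge hT))

theorem abs_sub_le_sqrt_discriminant (hT : T ≤ a * b) : |a - b| ≤ √((a + b) ^ 2 - 4 * T) := by
  rw [← Real.sqrt_sq_eq_abs]
  exact Real.sqrt_le_sqrt (discriminant_ge hT)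

theorem hasDerivAt_logMean (ha : 0 ≤ a) (hb : 0 < b) (hab : a ≠ b) (hT : T ≤ a * b) :
    HasDerivAt (logMean a b T) (rootKernel a b T) 0 := by
  have hS := sqrt_discriminant_pos hab hT
  have hD : (a + b) ^ 2 - 4 * T ≠ 0 := (Real.sqrt_pos.1 hS).ne'
  have hP := upperRoot_pos hb hT
  have h1 : HasDerivAt (fun t : ℝ => Real.exp (2 * t)) 2 0 := by
    simpa using ((hasDerivAt_id (0 : ℝ)).const_mul 2).exp
  have h2 : HasDerivAt (fun t : ℝ => Real.exp (2 * t) * a + b) (2 * a) 0 :=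
    (h1.mul_const a).add_const b
  have h3 : HasDerivAt (fun t : ℝ => (Real.exp (2 * t) * a + b) ^ 2
      - 4 * (Real.exp (2 * t) * T)) (2 * (a + b) * (2 * a) - 4 * (2 * T)) 0 := by
    exact ((h2.pow 2).sub ((h1.mul_const T).const_mul 4)).congr_deriv (by simp)
  have h4 := h3.sqrt (by simpa using hD)
  have h5 := (((h2.add h4).div_const 2).log (by simpa [upperRoot] using hP.ne')).div_const 2
  refine h5.congr_deriv ?_
  have hP' : 0 < a + b + √((a + b) ^ 2 - 4 * T) := by unfold upperRoot at hP; linarith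
  simp only [mul_zero, Real.exp_zero, one_mul, rootKernel, Pi.add_apply]
  have hsq := Real.sq_sqrt (discriminant_nonneg hT)
  generalize √((a + b) ^ 2 - 4 * T) = S at *
  field_simp
  ring

/-- With `S` the square root of the discriminant, the numerator is at least `a * (a - b + S)`, and
`S ≥ |a - b|`. If `S = 0` the quotient is `0` by convention. -/
theorem rootKernel_nonneg (ha : 0 ≤ a) (hb : 0 ≤ b) (hT : T ≤ a * b) : 0 ≤ rootKernel a b T := by
  have h1 := (abs_le.1 (abs_sub_le_sqrt_discriminant hT)).1
  have hS := Real.sqrt_nonneg ((a + b) ^ 2 - 4 * T)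
  refine div_nonneg ?_ (mul_nonneg hS (by linarith))
  nlinarith

theorem rootKernel_pos (hb : 0 ≤ b) (hba : b < a) (hT : T ≤ a * b) : 0 < rootKernel a b T := by
  have h1 := (abs_le.1 (abs_sub_le_sqrt_discriminant hT)).2
  have hS := sqrt_discriminant_pos hba.ne' hT
  refine div_pos ?_ (mul_pos hS (by linarith))
  nlinarith

/-- Dilating both points by `e^t` adds exactly `t` to the mean of `log |x - y|`, so the two partial
derivatives sum to `1`. -/
theorem rootKernel_add_swap (ha : 0 ≤ a) (hb : 0 ≤ b) (hab : a ≠ b) (hT : T ≤ a * b) :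
    rootKernel a b T + rootKernel b a T = 1 := by
  have hS := sqrt_discriminant_pos hab hT
  have hsq := Real.sq_sqrt (discriminant_nonneg hT)
  unfold rootKernel
  rw [add_comm b a]
  have hP : 0 < a + b + √((a + b) ^ 2 - 4 * T) := by linarith
  generalize √((a + b) ^ 2 - 4 * T) = S at *
  field_simp
  linarith

theorem rootKernel_le_one (ha : 0 ≤ a) (hb : 0 ≤ b) (hab : a ≠ b) (hT : T ≤ a * b) :
    rootKernel a b T ≤ 1 := by
  have h1 := rootKernel_add_swap ha hb hab hT
  have h2 := rootKernel_nonneg hb ha (by linarith : T ≤ b * a)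
  linarith

/-- The circular mean of `log |z - w|` in real terms. -/
theorem integral_log_eq_log_upperRoot (ha : 0 ≤ a) (hb : 0 < b) {α β : ℝ}
    (hT : α ^ 2 + β ^ 2 ≤ a * b) :
    ∫ θ in 0..2 * Real.pi, Real.log (a + b - 2 * (Real.cos θ * α + Real.sin θ * β)) / 2 =
      2 * Real.pi * (Real.log (upperRoot a b (α ^ 2 + β ^ 2)) / 2) := by
  set P := upperRoot a b (α ^ 2 + β ^ 2) with hPdef
  have hP : 0 < P := upperRoot_pos hb hT
  have hq : P ^ 2 - (a + b) * P + (α ^ 2 + β ^ 2) = 0 := upperRoot_quadratic hT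
  have hp : 0 < √P := Real.sqrt_pos.2 hP
  have hsq : √P ^ 2 = P := Real.sq_sqrt hP.le
  -- Since `P + T / P = a + b`, with `T = α² + β²`, the argument of the logarithm is `|√P e^{iθ} -
  -- w|²`. As `|w| ≤ √P`, the circle average of `log |· - w|` is `log √P`.
  set w : ℂ := ⟨α / √P, β / √P⟩ with hw
  have hmem : w ∈ Metric.closedBall (0 : ℂ) |√P| := by
    rw [mem_closedBall_zero_iff, abs_of_pos hp]
    refine abs_le_of_sq_le_sq' ?_ hp.le |>.2
    rw [Complex.sq_norm, Complex.normSq_mk, hsq]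
    have : α / √P * (α / √P) + β / √P * (β / √P) = (α ^ 2 + β ^ 2) / P := by
      rw [← sq, ← sq, div_pow, div_pow, hsq, add_div]
    rw [this, div_le_iff₀ hP]
    have h1 := left_le_upperRoot hT
    have h2 := right_le_upperRoot hT
    nlinarith
  have key := circleAverage_log_norm_sub_const_of_mem_closedBall hmem
  rw [Real.circleAverage_def, smul_eq_mul, inv_mul_eq_iff_eq_mul₀ (by positivity)] at key
  rw [Real.log_sqrt hP.le] at key
  rw [← key]
  refine intervalIntegral.integral_congr fun θ _ => ?_
  have hn : a + b - 2 * (Real.cos θ * α + Real.sin θ * β) =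
      ‖circleMap 0 (√P) θ - w‖ ^ 2 := by
    rw [Complex.sq_norm, Complex.normSq_apply]
    simp only [circleMap_zero, Complex.sub_re, Complex.sub_im, Complex.re_ofReal_mul,
      Complex.im_ofReal_mul, Complex.exp_ofReal_mul_I_re, Complex.exp_ofReal_mul_I_im, hw]
    have hcs := Real.sin_sq_add_cos_sq θ
    have e1 : (√P * Real.cos θ - α / √P) * (√P * Real.cos θ - α / √P) +
        (√P * Real.sin θ - β / √P) * (√P * Real.sin θ - β / √P) =
        √P ^ 2 * (Real.sin θ ^ 2 + Real.cos θ ^ 2) - 2 * (Real.cos θ * α + Real.sin θ * β) +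
          (α ^ 2 + β ^ 2) / √P ^ 2 := by
      field_simp
      ring
    rw [e1, hcs, hsq]
    field_simp
    linarith
  simp only [hn, Real.log_pow]
  push_cast
  ring

end UpperRoot

/-! ### Pointwise bounds for the logarithmic kernel. -/

theorem abs_log_div_le (a b : ℝ) : |Real.log (a / b)| ≤ |Real.log a| + |Real.log b| := by
  rcases eq_or_ne a 0 with rfl | ha
  · simp
  rcases eq_or_ne b 0 with rfl | hb
  · simp
  rw [Real.log_div ha hb]
  exact abs_sub _ _

/-- For `‖y‖ ≥ 2 * r > 0` the ratio lies in `[1/2, 2]`; nearer points are covered by the two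
truncated logarithms. -/
theorem abs_log_norm_div_le {F : Type*} [SeminormedAddCommGroup F] {z y : F} {r : ℝ} (hz : ‖z‖ = r) :
    |Real.log (‖y‖ / ‖z - y‖)| ≤ Real.log 2 +
      ((Set.Iio (2 * r)).indicator (fun r => |Real.log r|) ‖y‖ +
        (Set.Iio (3 * r)).indicator (fun r => |Real.log r|) ‖z - y‖) := by
  have hl2 : 0 ≤ Real.log 2 := Real.log_nonneg one_le_two
  have hind : ∀ (s : Set ℝ) (t : ℝ), 0 ≤ s.indicator (fun r => |Real.log r|) t := fun s t =>
    Set.indicator_nonneg (fun _ _ => abs_nonneg _) _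
  by_cases hy : ‖y‖ < 2 * r
  · have hzy : ‖z - y‖ < 3 * r := (norm_sub_le z y).trans_lt (by linarith)
    rw [Set.indicator_of_mem (show ‖y‖ ∈ Set.Iio (2 * r) from hy),
      Set.indicator_of_mem (show ‖z - y‖ ∈ Set.Iio (3 * r) from hzy)]
    linarith [abs_log_div_le ‖y‖ ‖z - y‖]
  · refine le_trans ?_ (le_add_of_nonneg_right (add_nonneg (hind _ _) (hind _ _)))
    push Not at hy
    rcases (norm_nonneg y).eq_or_lt with hy0 | hyp
    · simpa [← hy0] using hl2
    have h1 : ‖y‖ - ‖z‖ ≤ ‖z - y‖ := by rw [norm_sub_rev]; exact norm_sub_norm_le y z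
    have h2 := norm_sub_le z y
    have h3 : 0 < ‖z - y‖ := by linarith
    rw [abs_le, ← Real.log_inv]
    constructor
    · apply Real.log_le_log (by norm_num)
      rw [le_div_iff₀ h3]; linarith
    · apply Real.log_le_log (by positivity)
      rw [div_le_iff₀ h3]; linarith

/-! ### Complex structures and the circle action. -/

variable {E : Type*} [NormedAddCommGroup E] [InnerProductSpace ℝ E]

/-- A skew-symmetric isometry, i.e. multiplication by `i` for a unitary structure on `E`. -/
structure IsComplexStructure (J : E →ₗ[ℝ] E) : Prop where
  norm_map : ∀ x, ‖J x‖ = ‖x‖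
  inner_self : ∀ x, inner ℝ x (J x) = 0

/-- The squared modulus of the hermitian product associated with `J`. -/
noncomputable def hermitianSq (J : E →ₗ[ℝ] E) (x y : E) : ℝ := inner ℝ x y ^ 2 + inner ℝ (J x) y ^ 2

section ComplexStructure

variable {J : E →ₗ[ℝ] E}

/-- Polarizing `⟨x, J x⟩ = 0` shows that `J` is skew. -/
theorem hermitianSq_comm (hJ : IsComplexStructure J) (x y : E) :
    hermitianSq J x y = hermitianSq J y x := by
  have h := hJ.inner_self (x + y)
  simp only [map_add, inner_add_left, inner_add_right, hJ.inner_self] at h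
  have h' : inner ℝ (J x) y = -inner ℝ (J y) x := by
    rw [real_inner_comm (J x) y, real_inner_comm (J y) x] at *
    linarith
  rw [hermitianSq, hermitianSq, h', real_inner_comm, neg_sq]

theorem hermitianSq_le (hJ : IsComplexStructure J) (x y : E) :
    hermitianSq J x y ≤ ‖x‖ ^ 2 * ‖y‖ ^ 2 := by
  -- `v` is `‖x‖ ^ 2` times the projection of `y` onto the complex line of `x`; Cauchy–Schwarz for
  -- `v` and `y` gives the complex inequality.
  set v : E := inner ℝ x y • x + inner ℝ (J x) y • J x with hv
  have h1 : inner ℝ v y = hermitianSq J x y := by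
    simp [hv, inner_add_left, real_inner_smul_left, hermitianSq]
    ring
  have h2 : ‖v‖ ^ 2 = hermitianSq J x y * ‖x‖ ^ 2 := by
    rw [hv, norm_add_sq_real, norm_smul, norm_smul, real_inner_smul_left, real_inner_smul_right,
      hJ.inner_self, hJ.norm_map, mul_pow, mul_pow, Real.norm_eq_abs, Real.norm_eq_abs, sq_abs,
      sq_abs, hermitianSq]
    ring
  have h3 : hermitianSq J x y ^ 2 ≤ hermitianSq J x y * (‖x‖ ^ 2 * ‖y‖ ^ 2) := by
    rw [← mul_assoc, ← h2, ← mul_pow, ← h1]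
    exact sq_le_sq' (neg_le_of_abs_le (abs_real_inner_le_norm v y)) (real_inner_le_norm v y)
  have h0 : 0 ≤ hermitianSq J x y := by unfold hermitianSq; positivity
  rcases h0.eq_or_lt with h | h
  · rw [← h]; positivity
  · rw [sq] at h3
    exact le_of_mul_le_mul_left h3 h

theorem hermitianSq_smul_left (t : ℝ) (x y : E) :
    hermitianSq J (t • x) y = t ^ 2 * hermitianSq J x y := by
  simp only [hermitianSq, map_smul, real_inner_smul_left]
  ring

/-- Multiplication by `e^{iθ}`. -/
noncomputable def rotate (J : E →ₗ[ℝ] E) (θ : ℝ) (x : E) : E := Real.cos θ • x + Real.sin θ • J x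

theorem norm_rotate (hJ : IsComplexStructure J) (θ : ℝ) (x : E) : ‖rotate J θ x‖ = ‖x‖ := by
  have h : ‖rotate J θ x‖ ^ 2 = ‖x‖ ^ 2 := by
    rw [rotate, norm_add_sq_real, norm_smul, norm_smul, real_inner_smul_left,
      real_inner_smul_right, hJ.inner_self, hJ.norm_map, mul_pow, mul_pow, Real.norm_eq_abs,
      Real.norm_eq_abs, sq_abs, sq_abs]
    linear_combination ‖x‖ ^ 2 * Real.cos_sq_add_sin_sq θ
  exact (sq_eq_sq₀ (norm_nonneg _) (norm_nonneg _)).1 h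

theorem norm_rotate_sub_sq (hJ : IsComplexStructure J) (θ : ℝ) (x y : E) :
    ‖rotate J θ x - y‖ ^ 2 = ‖x‖ ^ 2 + ‖y‖ ^ 2 -
      2 * (Real.cos θ * inner ℝ x y + Real.sin θ * inner ℝ (J x) y) := by
  rw [norm_sub_sq_real, norm_rotate hJ, rotate, inner_add_left, real_inner_smul_left,
    real_inner_smul_left]
  ring

theorem continuous_rotate (J : E →ₗ[ℝ] E) (x : E) : Continuous fun θ => rotate J θ x := by
  unfold rotate
  fun_prop

theorem integral_log_norm_rotate_sub (hJ : IsComplexStructure J) (x : E) {y : E} (hy : y ≠ 0) :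
    ∫ θ in 0..2 * Real.pi, Real.log ‖rotate J θ x - y‖ =
      2 * Real.pi * logMean (‖x‖ ^ 2) (‖y‖ ^ 2) (hermitianSq J x y) 0 := by
  have h := integral_log_eq_log_upperRoot (sq_nonneg ‖x‖) (pow_pos (norm_pos_iff.2 hy) 2)
    (hermitianSq_le hJ x y)
  rw [logMean_zero]
  refine Eq.trans ?_ h
  refine intervalIntegral.integral_congr fun θ _ => ?_
  simp only [← norm_rotate_sub_sq hJ, Real.log_pow]
  push_cast
  ring

end ComplexStructure

/-! ### Integrability of log potentials and their circular averages. -/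

section LogPotential

variable [FiniteDimensional ℝ E] [MeasurableSpace E] [BorelSpace E]

theorem integrable_indicator_abs_log_norm (hE : 2 ≤ Module.finrank ℝ E) (R : ℝ)
    (μ : Measure E) [μ.IsAddHaarMeasure] :
    Integrable (fun x : E => (Set.Iio R).indicator (fun r => |Real.log r|) ‖x‖) μ := by
  have : Nontrivial E := Module.nontrivial_of_finrank_pos (R := ℝ) (by omega)
  rw [integrable_fun_norm_addHaar μ]
  set d := Module.finrank ℝ E
  -- In polar coordinates the density is `r ^ (d - 1) * |log r|`; one factor `r`, available as `d ≥
  -- 2`, makes it continuous at `0`.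
  have hc : Continuous fun r : ℝ => |r ^ (d - 2) * (r * Real.log r)| :=
    ((continuous_pow _).mul Real.continuous_mul_log).abs
  have h1 : IntegrableOn ((Set.Iio R).indicator fun r : ℝ => |r ^ (d - 2) * (r * Real.log r)|)
      (Set.Ioi 0) := by
    rw [integrableOn_indicator_iff measurableSet_Iio]
    exact (hc.integrableOn_Icc (a := 0) (b := R)).mono_set fun r hr => ⟨hr.2.le, hr.1.le⟩
  refine h1.congr_fun (fun r hr => ?_) measurableSet_Ioi
  have hr0 : (0 : ℝ) < r := hr
  have e : d - 1 = d - 2 + 1 := by omega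
  by_cases hrR : r ∈ Set.Iio R
  · simp only [Set.indicator_of_mem hrR, abs_mul, abs_pow, abs_of_pos hr0, smul_eq_mul, e,
      pow_succ]
    ring
  · simp [Set.indicator_of_notMem hrR]

/-- On a sphere, the absolute log potential of a continuous integrable density is bounded. -/
theorem exists_log_potential_bound (hE : 2 ≤ Module.finrank ℝ E) (μ : Measure E)
    [μ.IsAddHaarMeasure] {q : E → ℝ} (hq : Continuous q) (hqi : Integrable q μ) (r : ℝ) :
    ∃ M, ∀ z : E, ‖z‖ = r →
      Integrable (fun y => Real.log (‖y‖ / ‖z - y‖) * q y) μ ∧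
        ∫ y, ‖Real.log (‖y‖ / ‖z - y‖) * q y‖ ∂μ ≤ M := by
  -- Beyond radius `4 * r` both truncated logarithms vanish, because then `‖z - y‖ > 3 * r`.
  obtain ⟨M, hM⟩ := (isCompact_closedBall (0 : E) (4 * r)).exists_bound_of_continuousOn
    hq.continuousOn
  have hM' : ∀ y : E, ‖y‖ ≤ 4 * r → |q y| ≤ |M| := fun y hy =>
    (hM y (by simpa using hy)).trans (le_abs_self M)
  set l := fun R : ℝ => fun x : E => (Set.Iio R).indicator (fun r => |Real.log r|) ‖x‖ with hl
  have hli := fun R => integrable_indicator_abs_log_norm hE R μ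
  have hl0 : ∀ R x, 0 ≤ l R x := fun R x => Set.indicator_nonneg (fun _ _ => abs_nonneg _) _
  refine ⟨Real.log 2 * ∫ y, |q y| ∂μ +
    |M| * (∫ y, l (2 * r) y ∂μ + ∫ y, l (3 * r) y ∂μ), fun z hz => ?_⟩
  have hb : ∀ y, ‖Real.log (‖y‖ / ‖z - y‖) * q y‖ ≤
      Real.log 2 * |q y| + |M| * (l (2 * r) y + l (3 * r) (z - y)) := by
    intro y
    have hr : 0 ≤ r := hz ▸ norm_nonneg z
    rw [norm_mul, Real.norm_eq_abs, Real.norm_eq_abs]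
    refine (mul_le_mul_of_nonneg_right (abs_log_norm_div_le hz) (abs_nonneg _)).trans ?_
    change (Real.log 2 + (l (2 * r) y + l (3 * r) (z - y))) * |q y| ≤ _
    rw [add_mul]
    gcongr ?_ + ?_
    · exact le_rfl
    by_cases hy : ‖y‖ ≤ 4 * r
    · rw [mul_comm]
      exact mul_le_mul_of_nonneg_right (hM' y hy) (add_nonneg (hl0 _ _) (hl0 _ _))
    · push Not at hy
      have h1 : ‖y‖ - ‖z‖ ≤ ‖z - y‖ := by rw [norm_sub_rev]; exact norm_sub_norm_le y z
      have e1 : l (2 * r) y = 0 := Set.indicator_of_notMem (by simp; linarith) _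
      have e2 : l (3 * r) (z - y) = 0 := Set.indicator_of_notMem (by simp; linarith) _
      simp [e1, e2]
  have hi3 : Integrable (fun y => l (3 * r) (z - y)) μ := (hli (3 * r)).comp_sub_left z
  have h23 : Integrable (fun y => l (2 * r) y + l (3 * r) (z - y)) μ := (hli _).add hi3
  have hbi : Integrable (fun y =>
      Real.log 2 * |q y| + |M| * (l (2 * r) y + l (3 * r) (z - y))) μ :=
    (hqi.abs.const_mul _).add (h23.const_mul _)
  have hmeas : AEStronglyMeasurable (fun y => Real.log (‖y‖ / ‖z - y‖) * q y) μ :=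
    (Measurable.mul (by fun_prop) hq.measurable).aestronglyMeasurable
  have hint := hbi.mono' hmeas (.of_forall hb)
  refine ⟨hint, (integral_mono hint.norm hbi hb).trans_eq ?_⟩
  rw [integral_add (hqi.abs.const_mul _) (h23.const_mul _), integral_const_mul,
    integral_const_mul, integral_add (hli _) hi3, integral_sub_left_eq_self (l (3 * r)) μ z]

/-- Averaging the log potential over the circle action. -/
theorem integral_integral_log_rotate {J : E →ₗ[ℝ] E} (hJ : IsComplexStructure J)
    (hE : 2 ≤ Module.finrank ℝ E) (μ : Measure E) [μ.IsAddHaarMeasure] {q : E → ℝ}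
    (hq : Continuous q) (hqi : Integrable q μ) (x : E) :
    Integrable (fun y => (Real.log ‖y‖ -
        logMean (‖x‖ ^ 2) (‖y‖ ^ 2) (hermitianSq J x y) 0) * q y) μ ∧
      ∫ θ in 0..2 * Real.pi, ∫ y, Real.log (‖y‖ / ‖rotate J θ x - y‖) * q y ∂μ =
        2 * Real.pi * ∫ y, (Real.log ‖y‖ -
          logMean (‖x‖ ^ 2) (‖y‖ ^ 2) (hermitianSq J x y) 0) * q y ∂μ := by
  have : Nontrivial E := Module.nontrivial_of_finrank_pos (R := ℝ) (by omega)
  have hpi : (0 : ℝ) ≤ 2 * Real.pi := by positivity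
  obtain ⟨M, hM⟩ := exists_log_potential_bound hE μ hq hqi ‖x‖
  set F : ℝ → E → ℝ := fun θ y => Real.log (‖y‖ / ‖rotate J θ x - y‖) * q y with hF
  have hmeas : Measurable (Function.uncurry F) := by
    have := (continuous_rotate J x).measurable
    have := hq.measurable
    simp only [hF, Function.uncurry_def]
    fun_prop
  -- The bound `M` depends only on the norm, which rotation preserves; this justifies Fubini.
  have hint : Integrable (Function.uncurry F)
      ((volume.restrict (Set.Ioc 0 (2 * Real.pi))).prod μ) := by
    rw [integrable_prod_iff hmeas.aestronglyMeasurable]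
    refine ⟨.of_forall fun θ => (hM _ (norm_rotate hJ θ x)).1, ?_⟩
    refine Integrable.mono' (integrable_const M)
      hmeas.norm.stronglyMeasurable.integral_prod_right.aestronglyMeasurable
      (.of_forall fun θ => ?_)
    rw [Real.norm_of_nonneg (integral_nonneg fun _ => norm_nonneg _)]
    exact (hM _ (norm_rotate hJ θ x)).2
  have hsph : ∀ᵐ y ∂μ, y ∉ Metric.sphere (0 : E) ‖x‖ :=
    measure_eq_zero_iff_ae_notMem.1 (Measure.addHaar_sphere μ 0 ‖x‖)
  have hne : ∀ᵐ y ∂μ, y ∉ ({0} : Set E) := measure_eq_zero_iff_ae_notMem.1 (measure_singleton 0)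
  have hinner : ∀ᵐ y ∂μ, ∫ θ in Set.Ioc 0 (2 * Real.pi), F θ y =
      2 * Real.pi * ((Real.log ‖y‖ -
        logMean (‖x‖ ^ 2) (‖y‖ ^ 2) (hermitianSq J x y) 0) * q y) := by
    filter_upwards [hsph, hne] with y hy hy0
    have hxy : ∀ θ, ‖rotate J θ x - y‖ ≠ 0 := fun θ h => hy <| by
      rw [mem_sphere_zero_iff_norm, ← sub_eq_zero.1 (norm_eq_zero.1 h), norm_rotate hJ]
    have hc : Continuous fun θ => Real.log ‖rotate J θ x - y‖ :=
      ((continuous_rotate J x).sub continuous_const).norm.log hxy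
    have hsplit : ∀ θ, F θ y = (Real.log ‖y‖ - Real.log ‖rotate J θ x - y‖) * q y := fun θ => by
      simp only [hF]
      rw [Real.log_div (norm_ne_zero_iff.2 hy0) (hxy θ)]
    rw [← intervalIntegral.integral_of_le hpi]
    simp only [hsplit]
    rw [intervalIntegral.integral_mul_const, intervalIntegral.integral_sub
      intervalIntegrable_const (hc.intervalIntegrable _ _), integral_log_norm_rotate_sub hJ x hy0,
      intervalIntegral.integral_const]
    simp only [smul_eq_mul, sub_zero]
    ring
  constructor
  · have h := (hint.integral_prod_right.congr hinner).const_mul (2 * Real.pi)⁻¹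
    refine h.congr (.of_forall fun y => ?_)
    simp only
    field_simp
  · rw [intervalIntegral.integral_of_le hpi, integral_integral_swap hint,
      integral_congr_ae hinner, integral_const_mul]

end LogPotential

/-! ### The kernel `K` of the averaged logarithm. -/

theorem sq_norm_ne {F : Type*} [SeminormedAddCommGroup F] {x y : F} (h : ‖x‖ ≠ ‖y‖) :
    ‖x‖ ^ 2 ≠ ‖y‖ ^ 2 := fun h' =>
  h ((sq_eq_sq₀ (norm_nonneg _) (norm_nonneg _)).1 h')

/-- The derivative at `t = 0` of the circular mean of `log |e^t x - y|`. -/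
noncomputable def meanKernel (J : E →ₗ[ℝ] E) (x y : E) : ℝ :=
  rootKernel (‖x‖ ^ 2) (‖y‖ ^ 2) (hermitianSq J x y)

theorem abs_exp_sub_exp_le {a b M : ℝ} (ha : a ≤ M) (hb : b ≤ M) :
    |Real.exp a - Real.exp b| ≤ Real.exp M * |a - b| := by
  have key : ∀ {a b : ℝ}, a ≤ M → b ≤ a →
      |Real.exp a - Real.exp b| ≤ Real.exp M * |a - b| := fun {a b} ha h => by
    rw [abs_of_nonneg (sub_nonneg.2 (Real.exp_le_exp.2 h)), abs_of_nonneg (sub_nonneg.2 h)]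
    have h1 := Real.add_one_le_exp (b - a)
    have h2 : Real.exp b = Real.exp a * Real.exp (b - a) := by rw [← Real.exp_add]; congr 1; ring
    have h3 := Real.exp_le_exp.2 ha
    have h4 := Real.exp_pos a
    calc Real.exp a - Real.exp b ≤ Real.exp a * (a - b) := by rw [h2]; nlinarith
      _ ≤ Real.exp M * (a - b) := mul_le_mul_of_nonneg_right h3 (sub_nonneg.2 h)
  rcases le_total b a with h | h
  · exact key ha h
  · rw [abs_sub_comm, abs_sub_comm a]; exact key hb h

section Kernel

variable {J : E →ₗ[ℝ] E}

theorem meanKernel_nonneg (hJ : IsComplexStructure J) (x y : E) : 0 ≤ meanKernel J x y :=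
  rootKernel_nonneg (sq_nonneg _) (sq_nonneg _) (hermitianSq_le hJ x y)

theorem meanKernel_le_one (hJ : IsComplexStructure J) {x y : E} (h : ‖x‖ ≠ ‖y‖) :
    meanKernel J x y ≤ 1 :=
  rootKernel_le_one (sq_nonneg _) (sq_nonneg _) (sq_norm_ne h) (hermitianSq_le hJ x y)

theorem meanKernel_add_swap (hJ : IsComplexStructure J) {x y : E} (h : ‖x‖ ≠ ‖y‖) :
    meanKernel J x y + meanKernel J y x = 1 := by
  rw [meanKernel, meanKernel, hermitianSq_comm hJ y x]
  exact rootKernel_add_swap (sq_nonneg _) (sq_nonneg _) (sq_norm_ne h) (hermitianSq_le hJ x y)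

theorem meanKernel_pos (hJ : IsComplexStructure J) {x y : E} (h : ‖y‖ < ‖x‖) :
    0 < meanKernel J x y :=
  rootKernel_pos (sq_nonneg _) (pow_lt_pow_left₀ h (norm_nonneg _) two_ne_zero)
    (hermitianSq_le hJ x y)

theorem logMean_exp_smul (x y : E) (t : ℝ) :
    logMean (‖Real.exp t • x‖ ^ 2) (‖y‖ ^ 2) (hermitianSq J (Real.exp t • x) y) 0 =
      logMean (‖x‖ ^ 2) (‖y‖ ^ 2) (hermitianSq J x y) t := by
  have h : Real.exp t ^ 2 = Real.exp (2 * t) := by rw [← Real.exp_nat_mul]; norm_num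
  rw [logMean_zero, logMean, hermitianSq_smul_left, norm_smul, mul_pow, Real.norm_eq_abs, sq_abs, h]

variable [FiniteDimensional ℝ E] [MeasurableSpace E] [BorelSpace E]

theorem measurable_hermitianSq (J : E →ₗ[ℝ] E) :
    Measurable fun p : E × E => hermitianSq J p.1 p.2 := by
  have := J.continuous_of_finiteDimensional
  apply Continuous.measurable
  unfold hermitianSq
  fun_prop

theorem measurable_meanKernel (J : E →ₗ[ℝ] E) :
    Measurable fun p : E × E => meanKernel J p.1 p.2 := by
  have := measurable_hermitianSq J
  unfold meanKernel rootKernel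
  fun_prop

theorem measurable_logMean (J : E →ₗ[ℝ] E) (x : E) (t : ℝ) :
    Measurable fun y => logMean (‖x‖ ^ 2) (‖y‖ ^ 2) (hermitianSq J x y) t := by
  have : Measurable fun y => hermitianSq J x y :=
    (measurable_hermitianSq J).comp measurable_prodMk_left
  unfold logMean upperRoot
  fun_prop

end Kernel

/-! ### Dilation derivative of a radial potential and the Pohozaev identity. -/

section LogPotential

variable [FiniteDimensional ℝ E] [MeasurableSpace E] [BorelSpace E] {J : E →ₗ[ℝ] E}
  {μ : Measure E} [μ.IsAddHaarMeasure] {u q : E → ℝ} {c C : ℝ}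

/-- A radial log potential is a potential for the circular mean of the logarithm. -/
theorem radial_log_potential_eq (hJ : IsComplexStructure J) (hE : 2 ≤ Module.finrank ℝ E)
    (hq : Continuous q) (hqi : Integrable q μ) (hrad : ∀ x y, ‖x‖ = ‖y‖ → u x = u y)
    (hu : ∀ x, u x = c * ∫ y, Real.log (‖y‖ / ‖x - y‖) * q y ∂μ + C) (x : E) :
    u x = c * ∫ y, (Real.log ‖y‖ -
      logMean (‖x‖ ^ 2) (‖y‖ ^ 2) (hermitianSq J x y) 0) * q y ∂μ + C := by
  have h := (integral_integral_log_rotate hJ hE μ hq hqi x).2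
  have hpi : 2 * Real.pi ≠ 0 := by positivity
  rcases eq_or_ne c 0 with rfl | hc
  · simpa using hu x
  have h1 : ∀ θ, ∫ y, Real.log (‖y‖ / ‖rotate J θ x - y‖) * q y ∂μ = (u x - C) / c := fun θ => by
    rw [hrad x (rotate J θ x) (norm_rotate hJ θ x).symm, hu, add_sub_cancel_right,
      mul_div_cancel_left₀ _ hc]
  simp only [h1, intervalIntegral.integral_const, sub_zero, smul_eq_mul] at h
  rw [← mul_left_cancel₀ hpi h]
  field_simp
  ring

variable (hJ : IsComplexStructure J) (hE : 2 ≤ Module.finrank ℝ E)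
    (hq : Continuous q) (hqi : Integrable q μ)
    (hu : ∀ x, u x = c * ∫ y, (Real.log ‖y‖ -
      logMean (‖x‖ ^ 2) (‖y‖ ^ 2) (hermitianSq J x y) 0) * q y ∂μ + C)

include hJ hE hq hqi hu

/-- The Lipschitz constant in the logarithmic dilation parameter is uniform in `x`. It supplies the
domination for differentiating the volume, without asymptotics of `u` at infinity. -/
theorem abs_radial_potential_sub_le (x : E) (s t : ℝ) :
    |u (Real.exp s • x) - u (Real.exp t • x)| ≤ |c| * (∫ y, |q y| ∂μ) * |s - t| := by
  have : Nontrivial E := Module.nontrivial_of_finrank_pos (R := ℝ) (by omega)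
  have hi := fun t => (integral_integral_log_rotate hJ hE μ hq hqi (Real.exp t • x)).1
  rw [hu, hu, add_sub_add_right_eq_sub, ← mul_sub, ← integral_sub (hi s) (hi t), abs_mul, mul_assoc]
  refine mul_le_mul_of_nonneg_left ?_ (abs_nonneg c)
  rw [← integral_mul_const, ← Real.norm_eq_abs]
  refine norm_integral_le_of_norm_le (hqi.abs.mul_const _) ?_
  have hne : ∀ᵐ y ∂μ, y ∉ ({0} : Set E) := measure_eq_zero_iff_ae_notMem.1 (measure_singleton 0)
  filter_upwards [hne] with y hy
  rw [← sub_mul, sub_sub_sub_cancel_left, norm_mul, mul_comm, logMean_exp_smul, logMean_exp_smul,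
    abs_sub_comm s]
  exact mul_le_mul_of_nonneg_left (abs_logMean_sub_le (sq_nonneg _)
    (pow_pos (norm_pos_iff.2 hy) 2) (hermitianSq_le hJ x y) t s) (abs_nonneg _)

theorem hasDerivAt_radial_potential (x : E) :
    HasDerivAt (fun t => u (Real.exp t • x)) (-(c * ∫ y, meanKernel J x y * q y ∂μ)) 0 := by
  have : Nontrivial E := Module.nontrivial_of_finrank_pos (R := ℝ) (by omega)
  have hsph : ∀ᵐ y ∂μ, y ∉ Metric.sphere (0 : E) ‖x‖ :=
    measure_eq_zero_iff_ae_notMem.1 (Measure.addHaar_sphere μ 0 ‖x‖)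
  have hne : ∀ᵐ y ∂μ, y ∉ ({0} : Set E) := measure_eq_zero_iff_ae_notMem.1 (measure_singleton 0)
  have hi := (integral_integral_log_rotate hJ hE μ hq hqi x).1
  have key := (hasDerivAt_integral_of_dominated_loc_of_lip (μ := μ) (s := Set.univ)
    (bound := fun y => |q y|) (x₀ := (0 : ℝ)) (F' := fun y => -(meanKernel J x y * q y))
    (F := fun t y => (Real.log ‖y‖ -
      logMean (‖x‖ ^ 2) (‖y‖ ^ 2) (hermitianSq J x y) t) * q y) Filter.univ_mem
    (.of_forall fun t => ?_) hi ?_ ?_ hqi.abs ?_).2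
  · have h := (key.const_mul c).add_const C
    simp only [integral_neg, mul_neg] at h
    refine h.congr_of_eventuallyEq (.of_forall fun t => ?_)
    simp only [hu (Real.exp t • x), logMean_exp_smul]
  · exact ((((by fun_prop : Measurable fun y : E => Real.log ‖y‖).sub
      (measurable_logMean J x t))).mul hq.measurable).aestronglyMeasurable
  · exact ((measurable_meanKernel J).comp measurable_prodMk_left |>.mul
      hq.measurable).neg.aestronglyMeasurable
  · filter_upwards [hne] with y hy
    refine LipschitzOnWith.of_dist_le_mul fun s _ t _ => ?_
    rw [Real.dist_eq, Real.dist_eq, ← sub_mul, sub_sub_sub_cancel_left, abs_mul, mul_comm,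
      Real.coe_nnabs, abs_abs, abs_sub_comm s]
    exact mul_le_mul_of_nonneg_left (abs_logMean_sub_le (sq_nonneg _)
      (pow_pos (norm_pos_iff.2 hy) 2) (hermitianSq_le hJ x y) t s) (abs_nonneg _)
  · filter_upwards [hne, hsph] with y hy hs
    have hs' : ‖x‖ ≠ ‖y‖ := fun h => hs (by rw [mem_sphere_zero_iff_norm, h])
    refine (((hasDerivAt_logMean (sq_nonneg _) (pow_pos (norm_pos_iff.2 hy) 2) (sq_norm_ne hs')
      (hermitianSq_le hJ x y)).const_sub _).mul_const _).congr_deriv ?_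
    rw [neg_mul, meanKernel]

/-- The infinitesimal effect of dilations on the volume. -/
theorem volume_eq_kernel_integral {n : ℕ} (hn : Module.finrank ℝ E = n)
    (huc : Continuous u) (hw : Integrable (fun x => Real.exp (n * u x)) μ) :
    ∫ x, Real.exp (n * u x) ∂μ =
      c * ∫ x, Real.exp (n * u x) * ∫ y, meanKernel J x y * q y ∂μ ∂μ := by
  set K := |c| * (∫ y, |q y| ∂μ) with hK
  have hK0 : 0 ≤ K := mul_nonneg (abs_nonneg _) (integral_nonneg fun _ => abs_nonneg _)
  have hlip := abs_radial_potential_sub_le hJ hE hq hqi hu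
  have hqk : StronglyMeasurable fun x => ∫ y, meanKernel J x y * q y ∂μ :=
    StronglyMeasurable.integral_prod_right (f := fun x y => meanKernel J x y * q y)
      ((measurable_meanKernel J).mul (hq.measurable.comp measurable_snd)).stronglyMeasurable
  have key := (hasDerivAt_integral_of_dominated_loc_of_lip (μ := μ) (s := Set.Iio 1 ∩ Set.Ioi (-1))
    (bound := fun x => Real.exp (n * K) * (n * K) * Real.exp (n * u x)) (x₀ := (0 : ℝ))
    (F' := fun x => Real.exp (n * u x) * (n * -(c * ∫ y, meanKernel J x y * q y ∂μ)))
    (F := fun t x => Real.exp (n * u (Real.exp t • x)))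
    (Filter.inter_mem (Iio_mem_nhds one_pos) (Ioi_mem_nhds (by norm_num)))
    (.of_forall fun t => ?_) (by simpa using hw) ?_ ?_ (hw.const_mul _) ?_).2
  -- A change of variables evaluates the dilated volume as `e^{-nt} V`; uniqueness of the derivative
  -- at `0` gives the identity.
  · have h1 : ∀ t : ℝ, ∫ x, Real.exp (n * u (Real.exp t • x)) ∂μ =
        Real.exp (-(n * t)) * ∫ x, Real.exp (n * u x) ∂μ := fun t => by
      rw [Measure.integral_comp_smul μ (fun x => Real.exp (n * u x)), hn, abs_of_pos (by positivity),
        ← Real.exp_nat_mul, ← Real.exp_neg, smul_eq_mul]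
    simp only [h1] at key
    have h2 : HasDerivAt (fun t : ℝ => Real.exp (-(n * t)) * ∫ x, Real.exp (n * u x) ∂μ)
        (-n * ∫ x, Real.exp (n * u x) ∂μ) 0 := by
      have := (((hasDerivAt_id (0 : ℝ)).const_mul (n : ℝ)).neg.exp).mul_const
        (∫ x, Real.exp (n * u x) ∂μ)
      simpa using this
    have h3 := key.unique h2
    have h4 : ∀ x, Real.exp (n * u x) * (n * -(c * ∫ y, meanKernel J x y * q y ∂μ)) =
        (-n * c) * (Real.exp (n * u x) * ∫ y, meanKernel J x y * q y ∂μ) := fun x => by ring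
    simp only [h4, integral_const_mul] at h3
    have hn0 : (n : ℝ) ≠ 0 := by
      rw [Nat.cast_ne_zero]; omega
    have h5 : (-n : ℝ) * (c * ∫ x, Real.exp (n * u x) * ∫ y, meanKernel J x y * q y ∂μ ∂μ) =
      -n * ∫ x, Real.exp (n * u x) ∂μ := by rw [← h3]; ring
    exact (mul_left_cancel₀ (neg_ne_zero.2 hn0) h5).symm
  · exact (by fun_prop : Continuous fun x => Real.exp (n * u (Real.exp t • x))).aestronglyMeasurable
  · exact (Continuous.aestronglyMeasurable (by fun_prop)).mul
      ((hqk.aestronglyMeasurable.const_mul c).neg.const_mul _)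
  · refine .of_forall fun x => LipschitzOnWith.of_dist_le_mul fun s hs t ht => ?_
    -- For `|t| < 1` the Lipschitz bound gives `u (e^t x) ≤ K + u x`, hence an integrable majorant
    -- independent of `t`.
    have hb : ∀ t ∈ Set.Iio (1 : ℝ) ∩ Set.Ioi (-1),
        n * u (Real.exp t • x) ≤ n * K + n * u x := fun t ht => by
      have h := (abs_le.1 (hlip x t 0)).2
      rw [Real.exp_zero, one_smul, sub_zero] at h
      have h' : |t| ≤ 1 := abs_le.2 ⟨ht.2.le, ht.1.le⟩
      have h'' : u (Real.exp t • x) ≤ K + u x := by nlinarith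
      rw [← mul_add]
      exact mul_le_mul_of_nonneg_left h'' n.cast_nonneg
    rw [Real.dist_eq, Real.dist_eq, Real.coe_nnabs, abs_of_nonneg (mul_nonneg (mul_nonneg
      (Real.exp_pos _).le (mul_nonneg n.cast_nonneg hK0)) (Real.exp_pos _).le)]
    refine (abs_exp_sub_exp_le (hb s hs) (hb t ht)).trans ?_
    rw [← mul_sub, abs_mul, Nat.abs_cast, Real.exp_add]
    calc _ ≤ Real.exp (n * K) * Real.exp (n * u x) * (n * (K * |s - t|)) := by
          gcongr; exact hlip x s t
      _ = _ := by ring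
  · refine .of_forall fun x => ?_
    simpa using ((hasDerivAt_radial_potential hJ hE hq hqi hu x).const_mul (n : ℝ)).exp

end LogPotential

/-! ### Symmetrization of the kernel. -/

section Symmetrization

variable [FiniteDimensional ℝ E] [MeasurableSpace E] [BorelSpace E] {J : E →ₗ[ℝ] E}
  {μ : Measure E} [μ.IsAddHaarMeasure]

theorem ae_norm_ne [Nontrivial E] : ∀ᵐ p : E × E ∂μ.prod μ, ‖p.1‖ ≠ ‖p.2‖ := by
  rw [Measure.ae_prod_iff_ae_ae]
  · refine .of_forall fun x => ?_
    filter_upwards [measure_eq_zero_iff_ae_notMem.1 (Measure.addHaar_sphere μ 0 ‖x‖)] with y hy h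
    exact hy (by rw [mem_sphere_zero_iff_norm, h])
  · exact (measurableSet_eq_fun (by fun_prop) (by fun_prop)).compl

theorem integrable_meanKernel_mul [Nontrivial E] (hJ : IsComplexStructure J) {f : E × E → ℝ}
    (hf : Integrable f (μ.prod μ)) :
    Integrable (fun p => meanKernel J p.1 p.2 * f p) (μ.prod μ) := by
  refine hf.bdd_mul (c := 1) (measurable_meanKernel J).aestronglyMeasurable ?_
  filter_upwards [ae_norm_ne] with p hp
  rw [Real.norm_of_nonneg (meanKernel_nonneg hJ _ _)]
  exact meanKernel_le_one hJ hp

/-- Exchanging the variables preserves the integral, and the two kernels add up to `1` off the null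
set `‖x‖ = ‖y‖`. -/
theorem integral_meanKernel_mul_mul [Nontrivial E] (hJ : IsComplexStructure J) {w : E → ℝ}
    (hw : Integrable w μ) :
    ∫ p, meanKernel J p.1 p.2 * (w p.1 * w p.2) ∂μ.prod μ = (∫ x, w x ∂μ) ^ 2 / 2 := by
  have hi := integrable_meanKernel_mul hJ (hw.mul_prod hw)
  have h1 := integral_prod_swap (μ := μ) (ν := μ)
    fun p : E × E => meanKernel J p.1 p.2 * (w p.1 * w p.2)
  have h2 := integral_add hi hi.swap
  have h3 : ∫ p, (meanKernel J p.1 p.2 * (w p.1 * w p.2) +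
      ((fun p : E × E => meanKernel J p.1 p.2 * (w p.1 * w p.2)) ∘ Prod.swap) p) ∂μ.prod μ =
      ∫ p, w p.1 * w p.2 ∂μ.prod μ := by
    refine integral_congr_ae ?_
    filter_upwards [ae_norm_ne] with p hp
    simp only [Function.comp_apply, Prod.fst_swap, Prod.snd_swap]
    rw [mul_comm (w p.2), ← add_mul, meanKernel_add_swap hJ hp, one_mul]
  rw [integral_prod_mul] at h3
  simp only [Function.comp_apply] at h2 h3
  linarith

end Symmetrization

/-! ### The deficit identity on `ℝⁿ` and its vanishing. -/

theorem exists_isComplexStructure {n : ℕ} (hn : Even n) :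
    ∃ J : EuclideanSpace ℝ (Fin n) →ₗ[ℝ] EuclideanSpace ℝ (Fin n), IsComplexStructure J := by
  obtain ⟨m, rfl⟩ := hn
  let T := LinearIsometryEquiv.piLpCongrLeft 2 ℝ ℝ (finSumFinEquiv (m := m) (n := m)).symm
  -- On `ℝᵐ × ℝᵐ` this is `(a, b) ↦ (-b, a)`.
  let J₀ : EuclideanSpace ℝ (Fin m ⊕ Fin m) →ₗ[ℝ] EuclideanSpace ℝ (Fin m ⊕ Fin m) :=
    { toFun := fun x => WithLp.toLp 2 (Sum.elim (fun i => -x (.inr i)) fun i => x (.inl i))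
      map_add' := fun x y => by
        ext i
        rcases i with i | i <;> simp [add_comm]
      map_smul' := fun c x => by
        ext i
        rcases i with i | i <;> simp }
  have h1 : ∀ x, ‖J₀ x‖ = ‖x‖ := fun x => by
    rw [EuclideanSpace.norm_eq, EuclideanSpace.norm_eq, Fintype.sum_sum_type,
      Fintype.sum_sum_type, add_comm]
    simp [J₀]
  have h2 : ∀ x, inner ℝ x (J₀ x) = 0 := fun x => by
    simp [J₀, PiLp.inner_apply, Fintype.sum_sum_type, mul_comm]
  refine ⟨T.symm.toLinearEquiv.toLinearMap ∘ₗ J₀ ∘ₗ T.toLinearEquiv.toLinearMap,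
    fun x => ?_, fun x => ?_⟩
  · exact (T.symm.norm_map _).trans ((h1 _).trans (T.norm_map x))
  · have h : inner ℝ (T x) (T (T.symm (J₀ (T x)))) = 0 := by
      rw [T.apply_symm_apply]; exact h2 _
    rw [T.inner_map_map] at h
    exact h

theorem sphereVolume_ne_top (n : ℕ) : sphereVolume n ≠ ⊤ := measure_ne_top _ _

theorem sphereVolume_pos (n : ℕ) : 0 < sphereVolume n := by
  rw [sphereVolume, Measure.toSphere_apply_univ, finrank_euclideanSpace_fin]
  exact ENNReal.mul_pos (by simp) (Metric.measure_ball_pos _ _ one_pos).ne'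

theorem conformalVolume_eq_ofReal {n : ℕ} {u : EuclideanSpace ℝ (Fin n) → ℝ}
    (hw : Integrable fun x => Real.exp (n * u x)) :
    conformalVolume u = ENNReal.ofReal (∫ x, Real.exp (n * u x)) :=
  (ofReal_integral_eq_lintegral_ofReal hw (.of_forall fun _ => (Real.exp_pos _).le)).symm

theorem integrable_of_conformalVolume_ne_top {n : ℕ} {u : EuclideanSpace ℝ (Fin n) → ℝ}
    (hu : Continuous u) (h : conformalVolume u ≠ ⊤) :
    Integrable fun x => Real.exp (n * u x) :=
  (lintegral_ofReal_ne_top_iff_integrable (Continuous.aestronglyMeasurable (by fun_prop))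
    (.of_forall fun _ => (Real.exp_pos _).le)).1 h

/-- The deficit in Bol's inequality is a weighted integral of `(n - 1)! - Q`. -/
theorem volume_deficit_eq {n : ℕ} (hn : 2 ≤ n) {u Q : EuclideanSpace ℝ (Fin n) → ℝ}
    {J : EuclideanSpace ℝ (Fin n) →ₗ[ℝ] EuclideanSpace ℝ (Fin n)} (hJ : IsComplexStructure J)
    (hu : Continuous u) (hQ : Continuous Q) (hnormal : IsNormalSolution u Q)
    (hradial : IsRadial u) (hw : Integrable fun x => Real.exp (n * u x)) :
    Integrable (fun p : EuclideanSpace ℝ (Fin n) × EuclideanSpace ℝ (Fin n) =>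
        meanKernel J p.1 p.2 * (Real.exp (n * u p.1) *
          (((n - 1).factorial - Q p.2) * Real.exp (n * u p.2)))) (volume.prod volume) ∧
      (n - 1).factorial / 2 * (∫ x, Real.exp (n * u x)) *
          ((∫ x, Real.exp (n * u x)) - (sphereVolume n).toReal) =
        ∫ p : EuclideanSpace ℝ (Fin n) × EuclideanSpace ℝ (Fin n),
          meanKernel J p.1 p.2 * (Real.exp (n * u p.1) *
            (((n - 1).factorial - Q p.2) * Real.exp (n * u p.2))) ∂volume.prod volume := by
  have : Nontrivial (EuclideanSpace ℝ (Fin n)) :=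
    Module.nontrivial_of_finrank_pos (R := ℝ) (by simp; omega)
  have hE : Module.finrank ℝ (EuclideanSpace ℝ (Fin n)) = n := finrank_euclideanSpace_fin
  obtain ⟨C, hC⟩ := hnormal.integral_equation
  have hqi := hnormal.integrable
  have hq : Continuous fun x => Q x * Real.exp (n * u x) := by fun_prop
  have hvol := volume_eq_kernel_integral hJ (hn.trans_eq hE.symm) hq hqi
    (radial_log_potential_eq hJ (hn.trans_eq hE.symm) hq hqi hradial hC) hE hu hw
  have hi1 := integrable_meanKernel_mul hJ (hw.mul_prod hw)
  have hi2 := integrable_meanKernel_mul hJ (hw.mul_prod hqi)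
  have hB := integral_prod _ hi2
  simp only [mul_left_comm (meanKernel J _ _) (Real.exp _), integral_const_mul] at hB
  rw [← hB] at hvol
  have hsplit : (fun p : EuclideanSpace ℝ (Fin n) × EuclideanSpace ℝ (Fin n) =>
        meanKernel J p.1 p.2 * (Real.exp (n * u p.1) *
          (((n - 1).factorial - Q p.2) * Real.exp (n * u p.2)))) = fun p =>
      (n - 1).factorial * (meanKernel J p.1 p.2 * (Real.exp (n * u p.1) * Real.exp (n * u p.2))) -
        meanKernel J p.1 p.2 * (Real.exp (n * u p.1) * (Q p.2 * Real.exp (n * u p.2))) := by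
    ext p; ring
  rw [hsplit]
  refine ⟨(hi1.const_mul _).sub hi2, ?_⟩
  rw [integral_sub (hi1.const_mul _) hi2, integral_const_mul, integral_meanKernel_mul_mul hJ hw]
  simp only [mul_left_comm (meanKernel J _ _) (Real.exp _)]
  have hm : ((n - 1).factorial : ℝ) ≠ 0 := Nat.cast_ne_zero.2 (n - 1).factorial_ne_zero
  have hσ : (sphereVolume n).toReal ≠ 0 :=
    (ENNReal.toReal_pos (sphereVolume_pos n).ne' (sphereVolume_ne_top n)).ne'
  -- With `c = 2 / ((n-1)! |𝕊ⁿ|)` the Pohozaev identity reads `V (n-1)! |𝕊ⁿ| = 2 ∬ K w(x) Q(y)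
  -- w(y)`.
  rw [div_mul_eq_mul_div, eq_div_iff (mul_ne_zero hm hσ)] at hvol
  linear_combination (-1 / 2 : ℝ) * hvol

/-- If `Q y < m` at one point, continuity makes the set where `Q p.2 < m` and `‖p.2‖ < ‖p.1‖` open
and nonempty, so of positive measure; the nonnegative integrand is positive there. -/
theorem volume_deficit_eq_zero_iff {n : ℕ} (hn : 2 ≤ n) {u Q : EuclideanSpace ℝ (Fin n) → ℝ}
    {J : EuclideanSpace ℝ (Fin n) →ₗ[ℝ] EuclideanSpace ℝ (Fin n)} (hJ : IsComplexStructure J)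
    {m : ℝ} (hQ : Continuous Q) (hQle : ∀ x, Q x ≤ m)
    (hi : Integrable (fun p : EuclideanSpace ℝ (Fin n) × EuclideanSpace ℝ (Fin n) =>
        meanKernel J p.1 p.2 * (Real.exp (n * u p.1) *
          ((m - Q p.2) * Real.exp (n * u p.2)))) (volume.prod volume)) :
    ∫ p : EuclideanSpace ℝ (Fin n) × EuclideanSpace ℝ (Fin n),
          meanKernel J p.1 p.2 * (Real.exp (n * u p.1) *
            ((m - Q p.2) * Real.exp (n * u p.2))) ∂volume.prod volume = 0 ↔ ∀ x, Q x = m := by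
  have : Nontrivial (EuclideanSpace ℝ (Fin n)) :=
    Module.nontrivial_of_finrank_pos (R := ℝ) (by simp; omega)
  refine ⟨fun h => ?_, fun h => by simp [h]⟩
  rw [integral_eq_zero_iff_of_nonneg (fun p => mul_nonneg (meanKernel_nonneg hJ _ _)
    (mul_nonneg (Real.exp_pos _).le (mul_nonneg (sub_nonneg.2 (hQle _)) (Real.exp_pos _).le))) hi]
    at h
  by_contra! hne
  obtain ⟨y, hy⟩ := hne
  obtain ⟨x, hx⟩ := NormedSpace.exists_lt_norm ℝ (EuclideanSpace ℝ (Fin n)) ‖y‖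
  have hopen : IsOpen {p : EuclideanSpace ℝ (Fin n) × EuclideanSpace ℝ (Fin n) |
      Q p.2 < m ∧ ‖p.2‖ < ‖p.1‖} :=
    (isOpen_lt (hQ.comp continuous_snd) continuous_const).inter
      (isOpen_lt continuous_snd.norm continuous_fst.norm)
  have hpos := hopen.measure_pos (volume.prod volume) ⟨(x, y), (hQle y).lt_of_ne hy, hx⟩
  refine hpos.ne' (measure_mono_null ?_ h)
  rintro p ⟨h1, h2⟩
  exact (mul_pos (meanKernel_pos hJ h2) (mul_pos (Real.exp_pos _)
    (mul_pos (sub_pos.2 h1) (Real.exp_pos _)))).ne'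

end BolInequality

/-! ### Proof of the inequality and of the equality case. -/

theorem theorem1p1 (n : ℕ) (hn : 2 ≤ n) (heven : Even n)
    (u Q : EuclideanSpace ℝ (Fin n) → ℝ)
    (hu : ContDiff ℝ ∞ u) (hQ : ContDiff ℝ ∞ Q)
    (hnormal : BolInequality.IsNormalSolution u Q)
    (hradial : BolInequality.IsRadial u)
    (hQle : ∀ x, Q x ≤ (Nat.factorial (n - 1) : ℝ)) :
    BolInequality.sphereVolume n ≤ BolInequality.conformalVolume u ∧
      (BolInequality.conformalVolume u = BolInequality.sphereVolume n ↔
        ∀ x, Q x = (Nat.factorial (n - 1) : ℝ)) := by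
  obtain ⟨J, hJ⟩ := BolInequality.exists_isComplexStructure heven
  have hσ := BolInequality.sphereVolume_ne_top n
  by_cases hV : BolInequality.conformalVolume u = ⊤
  · refine ⟨hV ▸ le_top, fun h => absurd (h.symm.trans hV) hσ, fun h => ?_⟩
    -- If `Q` were constantly `(n-1)!`, integrability of `Q e^{nu}` would force finite volume.
    have hi := hnormal.integrable.const_mul (((n - 1).factorial : ℝ)⁻¹)
    simp only [h, inv_mul_cancel_left₀ (Nat.cast_ne_zero.2 (n - 1).factorial_ne_zero :
      ((n - 1).factorial : ℝ) ≠ 0)] at hi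
    exact absurd hV (BolInequality.conformalVolume_eq_ofReal hi ▸ ENNReal.ofReal_ne_top)
  have hw := BolInequality.integrable_of_conformalVolume_ne_top hu.continuous hV
  have hVpos : 0 < ∫ x, Real.exp (n * u x) :=
    integral_exp_pos hw
  obtain ⟨hi, hd⟩ := BolInequality.volume_deficit_eq hn hJ hu.continuous hQ.continuous hnormal
    hradial hw
  have hz := BolInequality.volume_deficit_eq_zero_iff hn hJ hQ.continuous hQle hi
  have hm : 0 < ((n - 1).factorial : ℝ) / 2 * ∫ x, Real.exp (n * u x) := by positivity
  -- As `(n-1)!/2 · V > 0`, equality of volumes is equivalent to the vanishing of the deficit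
  -- integral.
  rw [BolInequality.conformalVolume_eq_ofReal hw, ← ENNReal.ofReal_toReal hσ,
    ENNReal.ofReal_eq_ofReal_iff hVpos.le ENNReal.toReal_nonneg,
    ENNReal.ofReal_le_ofReal_iff hVpos.le, ← hz, ← hd, mul_eq_zero_iff_left hm.ne', sub_eq_zero]
  refine ⟨?_, Iff.rfl⟩
  have h0 : 0 ≤ (n - 1).factorial / 2 * (∫ x, Real.exp (n * u x)) *
      ((∫ x, Real.exp (n * u x)) - (BolInequality.sphereVolume n).toReal) := by
    rw [hd]
    exact integral_nonneg fun p => mul_nonneg (BolInequality.meanKernel_nonneg hJ _ _)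
      (mul_nonneg (Real.exp_pos _).le (mul_nonneg (sub_nonneg.2 (hQle _)) (Real.exp_pos _).le))
  exact sub_nonneg.1 (nonneg_of_mul_nonneg_right h0 hm)
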